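/- Let $\mathcal X,\mathcal Y$ be nonempty standard Borel spaces and let $(Z_t)_{t\in\mathbb Z}$, $Z_t=(X_t,Y_t)$, be a (not necessarily stationary) stochastic process with values in $\mathcal X\times\mathcal Y$. Let $\Pi$ be a probability measure on $\mathcal X\times\mathcal Y$ and, for integers $a\ge 1$, put $$\beta(a)=\sup_{t\ge 1}\ \mathbb E\big[\,\|\mathbf P_{t+a}(\cdot\mid Z_{-\infty}^{t})-\Pi\|_{TV}\big],$$ where $\mathbf P_{t+a}(\cdot\mid Z_{-\infty}^{t})$ is the conditional distribution of $Z_{t+a}$ given $(\dots,Z_{t-1},Z_t)$ and $\|\mu-\nu\|_{TV}=\sup_B|\mu(B)-\nu(B)|$. Assume that the process is exponentially $\beta$-mixing: $\beta(a)\le Ce^{-da}$ for all $a\ge1$, with constants $C,d>0$. Let $H$ be any set of functions $\mathcal X\to\mathcal Y$, let $L:\mathcal Y\times\mathcal Y\to[0,M]$ be a loss function, and write $\ell(h,(x,y))=L(h(x),y)$, assumed measurable in $(x,y)$ for each $h\in H$. Put $\mathcal L_\Pi(h)=\mathbb E_{\Pi}[\ell(h,Z)]$ and $$\mathfrak R_m(H,\Pi)=\frac1m\,\mathbb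 E\Big[\sup_{h\in H}\sum_{i=1}^m\sigma_i\,\ell(h,\widetilde Z_i)\Big],$$ with $\widetilde Z_1,\dots,\widetilde Z_m$ i.i.d. of law $\Pi$ and $\sigma_1,\dots,\sigma_m$ independent uniform signs, independent of the $\widetilde Z_i$ (outer expectations and outer probabilities are used where a supremum over $H$ is not measurable). Then block lengths of order $\log T$ give a remainder $\widetilde O(1/\sqrt T)$ with probability tending to one. Precisely: for all $p>0$, all $\kappa>(1+p)/d$ and all real $A$, there is a constant $K>0$ depending only on $C,d,p,\kappa,A$ such that the following holds for every integer $T\ge 2$, every integer $a$ with $\kappa\log T\le a\le A\log T$, and $m=\lfloor T/a\rfloor$ (so $T=ma$ when $a$ divides $T$): with probability at least $1-T^{-p}$, simultaneously for all $h\in H$, $$\mathcal L_\Pi(h)\ \le\ \frac1T\sum_{t=1}^T\ell(h,Z_t)+2\,\mathfrak R_m(H,\Pi)+K M\,\frac{\log T}{\sqrt T}.$$ -/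

import Mathlib

open MeasureTheory ProbabilityTheory

namespace TemporalBound

noncomputable section

/-- Total variation distance of two finite measures, `sup_B |μ(B) - ν(B)|` over measurable sets. -/
def tvDist {S : Type*} [MeasurableSpace S] (μ ν : Measure S) : ENNReal :=
  ⨆ (B : Set S) (_ : MeasurableSet B), ENNReal.ofReal |μ.real B - ν.real B|

/-- The past `(…, Z_{t-1}, Z_t)` of a doubly infinite sequence. -/
def past {Ω S : Type*} (Z : ℤ → Ω → S) (t : ℤ) (ω : Ω) : Set.Iic t → S :=
  fun s => Z s ω

/-- The mixing coefficient
`β(a) = sup_{t ≥ 1} 𝔼 ‖P_{t+a}(· | …, Z_{t-1}, Z_t) - Π‖_TV`,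
where `P_{t+a}(· | …, Z_{t-1}, Z_t)` is the regular conditional distribution of `Z_{t+a}` given the
past up to time `t`. Only the times `t ≥ 1` of the observed sample are used, so that the bound
`β(a) → 0` does not force the process to be stationary. -/
def betaCoeff {Ω S : Type*} [MeasurableSpace Ω] [MeasurableSpace S] [StandardBorelSpace S]
    [Nonempty S] (P : Measure Ω) [IsFiniteMeasure P] (Z : ℤ → Ω → S) (Pi : Measure S) (a : ℕ) :
    ENNReal :=
  ⨆ (t : ℤ) (_ : 1 ≤ t),
    ∫⁻ ω, tvDist (condDistrib (Z (t + a)) (past Z t) P (past Z t ω)) Pi ∂P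

/-- Exponential β-mixing with constants `C` and `d`: `β(a) ≤ C exp(-d a)` for all `a ≥ 1`. -/
def ExpBetaMixing {Ω S : Type*} [MeasurableSpace Ω] [MeasurableSpace S] [StandardBorelSpace S]
    [Nonempty S] (P : Measure Ω) [IsFiniteMeasure P] (Z : ℤ → Ω → S) (Pi : Measure S)
    (C d : ℝ) : Prop :=
  ∀ a : ℕ, 1 ≤ a → betaCoeff P Z Pi a ≤ ENNReal.ofReal (C * Real.exp (-d * a))

/-- The loss `ℓ(h, (x, y)) = L(h(x), y)` of the hypothesis `h` at the data point `(x, y)`. -/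
def lossAt {X Y : Type*} (L : Y → Y → ℝ) (h : X → Y) (z : X × Y) : ℝ :=
  L (h z.1) z.2

/-- The expected loss `𝓛_Π(h) = 𝔼_Π ℓ(h, Z)`. -/
def expectedLoss {X Y : Type*} [MeasurableSpace X] [MeasurableSpace Y] (L : Y → Y → ℝ)
    (Pi : Measure (X × Y)) (h : X → Y) : ℝ :=
  ∫ z, lossAt L h z ∂Pi

/-- The empirical loss `(1/T) ∑_{t=1}^T ℓ(h, Z_t)`. -/
def empiricalLoss {Ω X Y : Type*} (L : Y → Y → ℝ) (Z : ℤ → Ω → X × Y) (T : ℕ) (h : X → Y)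
    (ω : Ω) : ℝ :=
  (1 / (T : ℝ)) * ∑ t ∈ Finset.Icc 1 T, lossAt L h (Z (t : ℤ) ω)

/-- The upper (outer) expectation of a real function. It is the expectation when the function is
integrable, and it is also meaningful for suprema over uncountable classes, which need not be
measurable. -/
def upperExpectation {S : Type*} [MeasurableSpace S] (μ : Measure S) (f : S → ℝ) : ℝ :=
  sInf {r : ℝ | ∃ g : S → ℝ, Integrable g μ ∧ (∀ x, f x ≤ g x) ∧ r = ∫ x, g x ∂μ}

theorem upperExpectation_eq_integral {S : Type*} [MeasurableSpace S] (μ : Measure S) (f : S → ℝ)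
    (hf : Integrable f μ) : upperExpectation μ f = ∫ x, f x ∂μ := by
  apply IsLeast.csInf_eq
  refine ⟨⟨f, hf, fun _ => le_rfl, rfl⟩, ?_⟩
  rintro r ⟨g, hg, hfg, rfl⟩
  exact integral_mono hf hg hfg

/-- The Rademacher complexity
`ℜ_m(H, Π) = (1/m) 𝔼 [sup_{h ∈ H} ∑_{i=1}^m σ_i ℓ(h, Z̃_i)]`, with `Z̃_1, …, Z̃_m` independent of law
`Π` and independent signs `σ_i`, uniform on `{1, -1}`. The expectation over the signs is the average
over all `2 ^ m` sign vectors. -/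
def rademacher {X Y : Type*} [MeasurableSpace X] [MeasurableSpace Y] (L : Y → Y → ℝ)
    (H : Set (X → Y)) (Pi : Measure (X × Y)) (m : ℕ) : ℝ :=
  (1 / (m : ℝ)) * ((1 / (2 : ℝ) ^ m) * ∑ σ : Fin m → ℤˣ,
    upperExpectation (Measure.pi fun _ : Fin m => Pi)
      (fun z => ⨆ h : H, ∑ i, ((σ i : ℤ) : ℝ) * lossAt L (h : X → Y) (z i)))

end

end TemporalBound

/-! The sample is split into `a` interlaced combs of `m` points with gap `a`. Replacing the points
of a comb by independent ones of law `Pi`, last point first, costs at most `β(a)` per point, so an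
event that has probability `q` under the product law has probability at most `q + m β(a)` along the
comb (`measure_map_comb_le`). The dependence enters only there.

For an independent sample, McDiarmid's inequality and symmetrization bound all deviations at once by
`2 ℜ_m + M s` per point, outside a set of measure `exp (-m s² / 2)` (`exists_exceptional_set`). A
union bound over the combs, and averaging over them, give the bound for the full sample with
boundary error `2 a M / T` (`le_average_of_comb_le`). With `s` of order `log T / √T`, both parts of
the failure probability are at most `T ^ (-p) / 2` for large `T`; for small `T` a large `K` makes
the bound trivial.

Suprema over `H` need not be measurable. They are replaced by a measurable cover, whose minimality
lets it inherit bounded differences almost everywhere; McDiarmid's inequality is therefore proved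
under an almost-everywhere hypothesis. -/

namespace TemporalBound

/-! ### Upper expectations and measurable covers -/

section Majorant

variable {S : Type*} [MeasurableSpace S]

theorem integrable_of_abs_le (μ : Measure S) [IsFiniteMeasure μ] {g : S → ℝ} {B : ℝ}
    (hg : Measurable g) (hB : ∀ x, |g x| ≤ B) : Integrable g μ :=
  Integrable.of_bound hg.aestronglyMeasurable B (Filter.Eventually.of_forall hB)

theorem upperExpectation_le (μ : Measure S) [IsProbabilityMeasure μ] {f g : S → ℝ} {B : ℝ}
    (hB : ∀ x, -B ≤ f x) (hg : Integrable g μ) (hfg : ∀ x, f x ≤ g x) :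
    upperExpectation μ f ≤ ∫ x, g x ∂μ := by
  refine csInf_le ⟨-B, ?_⟩ ⟨g, hg, hfg, rfl⟩
  rintro r ⟨g', hg', hfg', rfl⟩
  calc -B = ∫ _, -B ∂μ := by simp
    _ ≤ _ := integral_mono (integrable_const _) hg' fun x => (hB x).trans (hfg' x)

/-- A measurable version of `g` is truncated to `[-B, B]`. It may fail to majorize `f` on a null
set, where the value `B` is used instead. -/
theorem exists_bounded_measurable_majorant (μ : Measure S) [IsProbabilityMeasure μ] {f g : S → ℝ}
    {B : ℝ} (hB : ∀ x, |f x| ≤ B) (hg : Integrable g μ) (hfg : ∀ x, f x ≤ g x) :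
    ∃ g' : S → ℝ, Measurable g' ∧ (∀ x, f x ≤ g' x) ∧ (∀ x, |g' x| ≤ B) ∧
      ∫ x, g' x ∂μ ≤ ∫ x, g x ∂μ := by
  classical
  obtain ⟨k, hk, hgk⟩ := hg.aestronglyMeasurable.aemeasurable
  set N := toMeasurable μ {x | ¬ g x = k x} with hN
  have hN0 : μ N = 0 := by rw [hN, measure_toMeasurable]; exact hgk
  have hNm : MeasurableSet N := measurableSet_toMeasurable _ _
  have hout : ∀ x ∉ N, g x = k x := fun x hx => by
    by_contra h
    exact hx (subset_toMeasurable _ _ h)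
  have hB0 : ∀ _ : S, 0 ≤ B := fun x => (abs_nonneg _).trans (hB x)
  set g' : S → ℝ := N.piecewise (fun _ => B) (fun x => max (-B) (min (k x) B)) with hg'
  have hm : Measurable g' := by
    refine Measurable.piecewise hNm measurable_const ?_
    fun_prop
  have hfg' : ∀ x, f x ≤ g' x := by
    intro x
    by_cases hx : x ∈ N
    · simp only [hg', Set.piecewise, hx, if_true]; exact (abs_le.1 (hB x)).2
    · simp only [hg', Set.piecewise, hx, if_false]
      exact le_max_of_le_right (le_min ((hfg x).trans (hout x hx).le) (abs_le.1 (hB x)).2)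
  have hb : ∀ x, |g' x| ≤ B := by
    intro x
    have := hB0 x
    by_cases hx : x ∈ N
    · simp only [hg', Set.piecewise, hx, if_true]; rw [abs_of_nonneg this]
    · simp only [hg', Set.piecewise, hx, if_false]
      exact abs_le.2 ⟨le_max_left _ _, max_le (by linarith) (min_le_right _ _)⟩
  refine ⟨g', hm, hfg', hb, integral_mono_ae (integrable_of_abs_le μ hm hb) hg ?_⟩
  have : ∀ᵐ x ∂μ, x ∉ N := measure_eq_zero_iff_ae_notMem.1 hN0
  filter_upwards [this] with x hx
  simp only [hg', Set.piecewise, hx, if_false]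
  rw [← hout x hx]
  exact max_le ((abs_le.1 (hB x)).1.trans (hfg x)) (min_le_left _ _)

/-- A bounded function has a measurable cover: the upper expectation is attained, and the cover is
almost everywhere below every integrable majorant. -/
theorem exists_measurable_cover (μ : Measure S) [IsProbabilityMeasure μ] {f : S → ℝ} {B : ℝ}
    (hB : ∀ x, |f x| ≤ B) :
    ∃ g : S → ℝ, Measurable g ∧ (∀ x, f x ≤ g x) ∧ (∀ x, |g x| ≤ B) ∧
      ∫ x, g x ∂μ = upperExpectation μ f ∧
      ∀ g' : S → ℝ, Integrable g' μ → (∀ x, f x ≤ g' x) → g ≤ᵐ[μ] g' := by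
  have hlow : ∀ x, -B ≤ f x := fun x => (abs_le.1 (hB x)).1
  have hne : {r : ℝ | ∃ g : S → ℝ, Integrable g μ ∧ (∀ x, f x ≤ g x) ∧
      r = ∫ x, g x ∂μ}.Nonempty :=
    ⟨_, fun _ => B, integrable_const _, fun x => (abs_le.1 (hB x)).2, rfl⟩
  have hbd : BddBelow {r : ℝ | ∃ g : S → ℝ, Integrable g μ ∧ (∀ x, f x ≤ g x) ∧
      r = ∫ x, g x ∂μ} := by
    refine ⟨upperExpectation μ f, ?_⟩
    rintro r ⟨g, hg, hfg, rfl⟩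
    exact upperExpectation_le μ hlow hg hfg
  obtain ⟨u, -, hu, hmem⟩ := exists_seq_tendsto_sInf hne hbd
  choose v hv hfv huv using hmem
  choose w hwm hfw hwB hwv using fun n => exists_bounded_measurable_majorant μ hB (hv n) (hfv n)
  have hbb : ∀ x, BddBelow (Set.range fun n => w n x) := fun x =>
    ⟨-B, by rintro _ ⟨n, rfl⟩; exact (abs_le.1 (hwB n x)).1⟩
  set g : S → ℝ := fun x => ⨅ n, w n x with hg
  have hgm : Measurable g := Measurable.iInf hwm
  have hfg : ∀ x, f x ≤ g x := fun x => le_ciInf fun n => hfw n x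
  have hgB : ∀ x, |g x| ≤ B := fun x => abs_le.2
    ⟨(hlow x).trans (hfg x), (ciInf_le (hbb x) 0).trans (abs_le.1 (hwB 0 x)).2⟩
  have hgi := integrable_of_abs_le μ hgm hgB
  have hint : ∫ x, g x ∂μ = upperExpectation μ f := by
    refine le_antisymm ?_ (upperExpectation_le μ hlow hgi hfg)
    refine ge_of_tendsto' hu fun n => ?_
    rw [huv n]
    refine le_trans ?_ (hwv n)
    exact integral_mono hgi (integrable_of_abs_le μ (hwm n) (hwB n)) fun x => ciInf_le (hbb x) n
  refine ⟨g, hgm, hfg, hgB, hint, fun g' hg' hfg' => ?_⟩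
  -- `min g g'` is again a majorant, so its integral cannot be below that of `g`; hence the two
  -- agree almost everywhere.
  have hmin : Integrable (fun x => min (g x) (g' x)) μ := hgi.inf hg'
  have h1 : ∫ x, g x ∂μ ≤ ∫ x, min (g x) (g' x) ∂μ := by
    rw [hint]
    exact upperExpectation_le μ hlow hmin fun x => le_min (hfg x) (hfg' x)
  have h2 : ∫ x, (g x - min (g x) (g' x)) ∂μ = 0 := by
    rw [integral_sub hgi hmin]
    have := integral_mono hmin hgi fun x => min_le_left _ _
    linarith
  rw [integral_eq_zero_iff_of_nonneg (fun x => sub_nonneg.2 (min_le_left _ _))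
    (hgi.sub hmin)] at h2
  filter_upwards [h2] with x hx
  have : g x = min (g x) (g' x) := sub_eq_zero.1 hx
  rw [this]
  exact min_le_right _ _

/-- The measurable cover of a function with bounded differences has almost everywhere bounded
differences. -/
theorem ae_ae_le_update_add (μ : Measure S) [IsProbabilityMeasure μ] {m : ℕ} {f g : (Fin m → S) → ℝ}
    {B c : ℝ} (hgm : Measurable g) (hgB : ∀ z, |g z| ≤ B) (hfg : ∀ z, f z ≤ g z)
    (hmin : ∀ g' : (Fin m → S) → ℝ, Integrable g' (Measure.pi fun _ => μ) → (∀ x, f x ≤ g' x) →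
      g ≤ᵐ[Measure.pi fun _ => μ] g')
    (hf : ∀ i z y, f z ≤ f (Function.update z i y) + c) (i : Fin m) :
    ∀ᵐ z ∂(Measure.pi fun _ : Fin m => μ), ∀ᵐ y ∂μ, g z ≤ g (Function.update z i y) + c := by
  have hu : Measurable fun p : (Fin m → S) × S => Function.update p.1 i p.2 := by
    refine measurable_pi_iff.2 fun j => ?_
    by_cases hj : j = i
    · subst hj; simpa using measurable_snd
    · simp only [Function.update_of_ne hj]; fun_prop
  -- For fixed `y` the right-hand side is a majorant of `f` in `z`, so minimality applies, with a
  -- null set depending on `y`. Fubini then restores the order of the quantifiers.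
  rw [Measure.ae_ae_comm]
  · refine Filter.Eventually.of_forall fun y => ?_
    have huy : Measurable fun z : Fin m → S => Function.update z i y :=
      hu.comp (measurable_id.prodMk measurable_const)
    refine hmin (fun z => g (Function.update z i y) + c) ?_ fun z => ?_
    · exact (integrable_of_abs_le _ (hgm.comp huy) fun z => hgB _).add (integrable_const _)
    · exact (hf i z y).trans (add_le_add_left (hfg _) c)
  · exact measurableSet_le (hgm.comp measurable_fst) ((hgm.comp hu).add_const c)

end Majorant

/-! ### McDiarmid's inequality -/

section McDiarmid

variable {S : Type*} [MeasurableSpace S]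

/-- Averaging the hypothesis over `y`, respectively over `x`, puts `G` within `c` of its mean.
Hoeffding's lemma on an interval of length `2 c` gives variance proxy `c ^ 2`. -/
theorem integral_exp_le_of_ae_sub_le (μ : Measure S) [IsProbabilityMeasure μ] {G : S → ℝ} {B c : ℝ}
    (hG : Measurable G) (hB : ∀ x, |G x| ≤ B) (hc : ∀ᵐ x ∂μ, ∀ᵐ y ∂μ, G x ≤ G y + c) (l : ℝ) :
    ∫ x, Real.exp (l * G x) ∂μ ≤ Real.exp (l * ∫ x, G x ∂μ + l ^ 2 * c ^ 2 / 2) := by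
  have hi := integrable_of_abs_le μ hG hB
  set E := ∫ x, G x ∂μ with hE
  have hup : ∀ᵐ x ∂μ, G x ≤ E + c := by
    filter_upwards [hc] with x hx
    have := integral_mono_ae (integrable_const (G x)) (hi.add (integrable_const c)) hx
    simp only [Pi.add_apply] at this
    rw [integral_add hi (integrable_const c)] at this
    simpa using this
  have hlo : ∀ᵐ y ∂μ, E - c ≤ G y := by
    have hc' : ∀ᵐ y ∂μ, ∀ᵐ x ∂μ, G x ≤ G y + c := by
      rw [Measure.ae_ae_comm] at hc
      · exact hc
      · exact measurableSet_le (hG.comp measurable_fst) ((hG.comp measurable_snd).add_const c)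
    filter_upwards [hc'] with y hy
    have := integral_mono_ae hi (integrable_const (G y + c)) hy
    simp only [integral_const, probReal_univ, one_smul] at this
    linarith
  have hs := hasSubgaussianMGF_of_mem_Icc (a := E - c) (b := E + c) hG.aemeasurable
    (by filter_upwards [hup, hlo] with x h1 h2 using ⟨h2, h1⟩)
  have := hs.mgf_le l
  simp only [mgf] at this
  have h3 : ∀ x, Real.exp (l * G x) = Real.exp (l * E) * Real.exp (l * (G x - E)) := fun x => by
    rw [← Real.exp_add]; ring_nf
  simp_rw [h3]
  rw [integral_const_mul, Real.exp_add]
  gcongr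
  refine this.trans (le_of_eq ?_)
  congr 1
  have : (((‖E + c - (E - c)‖₊ / 2) ^ 2 : NNReal) : ℝ) = c ^ 2 := by
    push_cast
    rw [Real.norm_eq_abs, div_pow, sq_abs]
    ring
  rw [this]; ring

theorem measurable_cons {m : ℕ} :
    Measurable fun p : S × (Fin m → S) => (Fin.cons p.1 p.2 : Fin (m + 1) → S) := by
  refine measurable_pi_iff.2 fun j => ?_
  refine Fin.cases ?_ (fun j => ?_) j
  · simpa using measurable_fst
  · simp only [Fin.cons_succ]; fun_prop

theorem measurePreserving_cons (μ : Measure S) [IsProbabilityMeasure μ] (m : ℕ) :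
    MeasurePreserving (fun p : S × (Fin m → S) => (Fin.cons p.1 p.2 : Fin (m + 1) → S))
      (μ.prod (Measure.pi fun _ => μ)) (Measure.pi fun _ => μ) := by
  have h := (measurePreserving_piFinSuccAbove (fun _ : Fin (m + 1) => μ) 0).symm
  convert h using 1
  funext p
  simp [MeasurableEquiv.piFinSuccAbove_symm_apply, Fin.insertNthEquiv]

/-- McDiarmid's inequality for the moment generating function, with almost everywhere bounded
differences. -/
theorem integral_exp_le_of_bounded_differences (μ : Measure S) [IsProbabilityMeasure μ] {B c : ℝ}
    (l : ℝ) :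
    ∀ (m : ℕ) (F : (Fin m → S) → ℝ), Measurable F → (∀ z, |F z| ≤ B) →
      (∀ i, ∀ᵐ z ∂(Measure.pi fun _ : Fin m => μ), ∀ᵐ y ∂μ, F z ≤ F (Function.update z i y) + c) →
      ∫ z, Real.exp (l * F z) ∂(Measure.pi fun _ => μ) ≤
        Real.exp (l * ∫ z, F z ∂(Measure.pi fun _ => μ) + m * (l ^ 2 * c ^ 2 / 2))
  | 0, F, hF, hB, _ => by
      rw [Measure.pi_of_empty (fun _ : Fin 0 => μ) Fin.elim0]
      simp
  | m + 1, F, hF, hB, hc => by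
      have hmp := measurePreserving_cons μ m
      have hFc : Measurable fun p : S × (Fin m → S) => F (Fin.cons p.1 p.2) :=
        hF.comp measurable_cons
      have hchange : ∀ φ : (Fin (m + 1) → S) → ℝ, Measurable φ →
          ∫ z, φ z ∂(Measure.pi fun _ => μ) =
            ∫ p, φ (Fin.cons p.1 p.2) ∂(μ.prod (Measure.pi fun _ : Fin m => μ)) := by
        intro φ hφ
        rw [← hmp.map_eq, integral_map hmp.measurable.aemeasurable hφ.aestronglyMeasurable]
      have hcI : ∀ i, ∀ᵐ y ∂μ, ∀ᵐ z ∂(Measure.pi fun _ : Fin m => μ), ∀ᵐ y' ∂μ,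
          F (Fin.cons y z) ≤ F (Function.update (Fin.cons y z : Fin (m + 1) → S) i y') + c :=
        fun i => Measure.ae_ae_of_ae_prod (hmp.quasiMeasurePreserving.ae (hc i))
      -- The induction conditions on the first coordinate: the slices `F (Fin.cons y ·)` have mean
      -- `G y` and fall under the case `m`, while `G` inherits bounded differences and is handled by
      -- the one-variable bound.
      set G : S → ℝ := fun y => ∫ z, F (Fin.cons y z) ∂(Measure.pi fun _ : Fin m => μ) with hG
      have hGm : Measurable G := hFc.stronglyMeasurable.integral_prod_right.measurable
      have hsl : ∀ y, Measurable fun z : Fin m → S => F (Fin.cons y z) := fun y =>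
        hFc.comp (measurable_const.prodMk measurable_id)
      have hsi : ∀ y, Integrable (fun z : Fin m → S => F (Fin.cons y z))
          (Measure.pi fun _ : Fin m => μ) := fun y =>
        integrable_of_abs_le _ (hsl y) fun z => hB _
      have hGB : ∀ y, |G y| ≤ B := fun y => by
        have := norm_integral_le_of_norm_le_const (μ := Measure.pi fun _ : Fin m => μ)
          (f := fun z => F (Fin.cons y z)) (C := B) (Filter.Eventually.of_forall fun z => hB (Fin.cons y z))
        simpa [Real.norm_eq_abs] using this
      have hGc : ∀ᵐ y ∂μ, ∀ᵐ y' ∂μ, G y ≤ G y' + c := by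
        filter_upwards [hcI 0] with y hy
        rw [Measure.ae_ae_comm] at hy
        · filter_upwards [hy] with y' hy'
          have := integral_mono_ae (hsi y) ((hsi y').add (integrable_const c))
            (by filter_upwards [hy'] with z hz; simpa [Fin.update_cons_zero] using hz)
          simp only [Pi.add_apply] at this
          rw [integral_add (hsi y') (integrable_const c)] at this
          simpa using this
        · simp only [Fin.update_cons_zero]
          refine measurableSet_le (hFc.comp (by fun_prop : Measurable fun p : (Fin m → S) × S =>
            (y, p.1))) (Measurable.add_const ?_ c)
          exact hFc.comp (by fun_prop : Measurable fun p : (Fin m → S) × S => (p.2, p.1))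
      have hexpm : Measurable fun z : Fin (m + 1) → S => Real.exp (l * F z) := by fun_prop
      have hexpB : ∀ z : Fin (m + 1) → S, |Real.exp (l * F z)| ≤ Real.exp (|l| * B) := fun z => by
        rw [abs_of_pos (Real.exp_pos _)]
        refine Real.exp_le_exp.2 ((le_abs_self _).trans ?_)
        rw [abs_mul]
        exact mul_le_mul_of_nonneg_left (hB z) (abs_nonneg l)
      have hFi : Integrable (fun p : S × (Fin m → S) => F (Fin.cons p.1 p.2))
          (μ.prod (Measure.pi fun _ : Fin m => μ)) :=
        integrable_of_abs_le _ hFc fun p => hB _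
      have hei : Integrable (fun p : S × (Fin m → S) => Real.exp (l * F (Fin.cons p.1 p.2)))
          (μ.prod (Measure.pi fun _ : Fin m => μ)) :=
        integrable_of_abs_le _ (hexpm.comp measurable_cons) fun p => hexpB _
      rw [hchange _ hexpm, hchange F hF, integral_prod _ hei, integral_prod _ hFi]
      have hstep : ∀ᵐ y ∂μ, ∫ z, Real.exp (l * F (Fin.cons y z)) ∂(Measure.pi fun _ : Fin m => μ) ≤
          Real.exp (l * G y) * Real.exp (m * (l ^ 2 * c ^ 2 / 2)) := by
        have hall : ∀ᵐ y ∂μ, ∀ i : Fin m, ∀ᵐ z ∂(Measure.pi fun _ : Fin m => μ), ∀ᵐ y' ∂μ,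
            F (Fin.cons y z) ≤ F (Fin.cons y (Function.update z i y')) + c := by
          refine ae_all_iff.2 fun i => ?_
          filter_upwards [hcI i.succ] with y hy
          simpa only [Fin.cons_update] using hy
        filter_upwards [hall] with y hy
        rw [← Real.exp_add]
        exact integral_exp_le_of_bounded_differences μ l m (fun z => F (Fin.cons y z)) (hsl y)
          (fun z => hB _) hy
      have hGe : Integrable (fun y => Real.exp (l * G y)) μ := by
        refine integrable_of_abs_le (B := Real.exp (|l| * B)) _ (by fun_prop) fun y => ?_
        rw [abs_of_pos (Real.exp_pos _)]
        refine Real.exp_le_exp.2 ((le_abs_self _).trans ?_)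
        rw [abs_mul]
        exact mul_le_mul_of_nonneg_left (hGB y) (abs_nonneg l)
      refine (integral_mono_ae hei.integral_prod_left (hGe.mul_const _) hstep).trans ?_
      rw [integral_mul_const]
      have := integral_exp_le_of_ae_sub_le μ hGm hGB hGc l
      calc _ ≤ Real.exp (l * ∫ x, G x ∂μ + l ^ 2 * c ^ 2 / 2) *
            Real.exp (m * (l ^ 2 * c ^ 2 / 2)) := by gcongr
        _ = _ := by rw [← Real.exp_add]; congr 1; push_cast; ring

theorem measure_ge_le_of_bounded_differences (μ : Measure S) [IsProbabilityMeasure μ] {B c s : ℝ}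
    {m : ℕ} (hc0 : 0 < c) (hs : 0 ≤ s) {F : (Fin m → S) → ℝ} (hF : Measurable F)
    (hB : ∀ z, |F z| ≤ B)
    (hc : ∀ i, ∀ᵐ z ∂(Measure.pi fun _ : Fin m => μ), ∀ᵐ y ∂μ,
      F z ≤ F (Function.update z i y) + c) :
    (Measure.pi fun _ : Fin m => μ) {z | ∫ z, F z ∂(Measure.pi fun _ => μ) + m * c * s ≤ F z} ≤
      ENNReal.ofReal (Real.exp (-(m * s ^ 2 / 2))) := by
  set ν := Measure.pi fun _ : Fin m => μ
  -- The Chernoff parameter `s / c` is optimal: the exponent becomes `m * s ^ 2 / 2 - m * s ^ 2`.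
  have h1 := integral_exp_le_of_bounded_differences μ (s / c) m F hF hB hc
  have hei : Integrable (fun z => Real.exp (s / c * F z)) ν := by
    refine integrable_of_abs_le (B := Real.exp (s / c * B)) _ (by fun_prop) fun y => ?_
    rw [abs_of_pos (Real.exp_pos _)]
    have := (abs_le.1 (hB y)).2
    gcongr
  have h2 := measure_ge_le_exp_mul_mgf (∫ z, F z ∂ν + m * c * s)
    (div_nonneg hs hc0.le) hei
  rw [← ofReal_measureReal]
  refine ENNReal.ofReal_le_ofReal (h2.trans ?_)
  simp only [mgf]
  refine (mul_le_mul_of_nonneg_left h1 (Real.exp_pos _).le).trans (le_of_eq ?_)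
  rw [← Real.exp_add]
  congr 1
  field_simp
  ring

end McDiarmid

/-! ### Signed sums and coordinate swaps -/

section Signs

variable {S ι : Type*} {u : ι → S → ℝ} {M : ℝ}

/-- The vector that takes its `i`-th coordinate from `w` if `σ i = 1` and from `z` otherwise. -/
def signMix {m : ℕ} (σ : Fin m → ℤˣ) (z w : Fin m → S) : Fin m → S :=
  fun i => if σ i = 1 then w i else z i

/-- The signed sum `∑ σ_i u(h, z_i)`, maximized over the index `h`. -/
noncomputable def signSup (u : ι → S → ℝ) {m : ℕ} (σ : Fin m → ℤˣ) (z : Fin m → S) : ℝ :=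
  ⨆ h, ∑ i, ((σ i : ℤ) : ℝ) * u h (z i)

theorem abs_sign_mul_le (σ : ℤˣ) {x M : ℝ} (hx : 0 ≤ x ∧ x ≤ M) :
    |((σ : ℤ) : ℝ) * x| ≤ M := by
  rcases Int.units_eq_one_or σ with h | h <;> simp [h, abs_of_nonneg hx.1, hx.2]

theorem abs_sum_le_mul {m : ℕ} {v : Fin m → ℝ} {M : ℝ} (h : ∀ i, |v i| ≤ M) :
    |∑ i, v i| ≤ m * M := by
  refine (Finset.abs_sum_le_sum_abs _ _).trans ((Finset.sum_le_sum fun i _ => h i).trans ?_)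
  simp

theorem abs_ciSup_le [Nonempty ι] {v : ι → ℝ} {B : ℝ} (h : ∀ i, |v i| ≤ B) : |⨆ i, v i| ≤ B := by
  have hb : BddAbove (Set.range v) := ⟨B, by rintro _ ⟨i, rfl⟩; exact (abs_le.1 (h i)).2⟩
  obtain ⟨i⟩ := ‹Nonempty ι›
  exact abs_le.2 ⟨(abs_le.1 (h i)).1.trans (le_ciSup hb i), ciSup_le fun i => (abs_le.1 (h i)).2⟩

theorem abs_signSum_le (hu : ∀ h x, 0 ≤ u h x ∧ u h x ≤ M) {m : ℕ} (σ : Fin m → ℤˣ)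
    (z : Fin m → S) (h : ι) : |∑ i, ((σ i : ℤ) : ℝ) * u h (z i)| ≤ m * M :=
  abs_sum_le_mul fun _ => abs_sign_mul_le _ (hu _ _)

theorem le_signSup (hu : ∀ h x, 0 ≤ u h x ∧ u h x ≤ M) {m : ℕ} (σ : Fin m → ℤˣ)
    (z : Fin m → S) (h : ι) : ∑ i, ((σ i : ℤ) : ℝ) * u h (z i) ≤ signSup u σ z :=
  le_ciSup (f := fun h => ∑ i, ((σ i : ℤ) : ℝ) * u h (z i))
    ⟨m * M, by rintro _ ⟨h, rfl⟩; exact (abs_le.1 (abs_signSum_le hu σ z h)).2⟩ h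

theorem abs_signSup_le [Nonempty ι] (hu : ∀ h x, 0 ≤ u h x ∧ u h x ≤ M) {m : ℕ} (σ : Fin m → ℤˣ)
    (z : Fin m → S) : |signSup u σ z| ≤ m * M :=
  abs_ciSup_le fun h => abs_signSum_le hu σ z h

/-- Of the two mixed vectors, one receives `w i` with sign `+` and the other `z i` with sign `-`.
This holds for each fixed `σ`, so symmetrization needs no joint measurability in the signs. -/
theorem sum_sub_eq_signMix {m : ℕ} (f : S → ℝ) (σ : Fin m → ℤˣ) (z w : Fin m → S) :
    ∑ i, (f (w i) - f (z i)) = ∑ i, ((σ i : ℤ) : ℝ) * f (signMix σ z w i) +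
      ∑ i, (((-σ) i : ℤ) : ℝ) * f (signMix (-σ) z w i) := by
  rw [← Finset.sum_add_distrib]
  refine Finset.sum_congr rfl fun i _ => ?_
  rcases Int.units_eq_one_or (σ i) with h | h <;> simp [signMix, h] <;> ring

end Signs

/-! ### Symmetrization and the independent sample -/

section Symmetrization

variable {S ι : Type*} [MeasurableSpace S]

theorem measurable_signMix {m : ℕ} (σ : Fin m → ℤˣ) :
    Measurable fun p : (Fin m → S) × (Fin m → S) => signMix σ p.1 p.2 := by
  refine measurable_pi_iff.2 fun i => ?_
  by_cases h : σ i = 1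
  · simp only [signMix, h, if_true]; fun_prop
  · simp only [signMix, h, if_false]; fun_prop

theorem measurePreserving_signMix (μ : Measure S) [IsProbabilityMeasure μ] {m : ℕ}
    (σ : Fin m → ℤˣ) :
    MeasurePreserving (fun p : (Fin m → S) × (Fin m → S) => signMix σ p.1 p.2)
      ((Measure.pi fun _ => μ).prod (Measure.pi fun _ => μ)) (Measure.pi fun _ => μ) := by
  refine ⟨measurable_signMix σ, (Measure.pi_eq fun s hs => ?_).symm⟩
  rw [Measure.map_apply (measurable_signMix σ) (MeasurableSet.univ_pi hs)]
  -- Each coordinate constrains exactly one of `z` and `w`, so the preimage of a box is a product of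
  -- two boxes.
  have : (fun p : (Fin m → S) × (Fin m → S) => signMix σ p.1 p.2) ⁻¹' Set.univ.pi s =
      (Set.univ.pi fun i => if σ i = 1 then Set.univ else s i) ×ˢ
        (Set.univ.pi fun i => if σ i = 1 then s i else Set.univ) := by
    ext ⟨z, w⟩
    simp only [signMix, Set.mem_preimage, Set.mem_univ_pi, Set.mem_prod, ← forall_and]
    refine forall_congr' fun i => ?_
    split_ifs <;> simp
  rw [this, Measure.prod_prod, Measure.pi_pi, Measure.pi_pi, ← Finset.prod_mul_distrib]
  refine Finset.prod_congr rfl fun i _ => ?_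
  split_ifs <;> simp

/-- The largest deviation `∑ (𝔼 u(h, ·) - u(h, z_i))` over the index `h`. -/
noncomputable def devSup (u : ι → S → ℝ) (μ : Measure S) {m : ℕ} (z : Fin m → S) : ℝ :=
  ⨆ h, ∑ i, (∫ x, u h x ∂μ - u h (z i))

variable {u : ι → S → ℝ} {M : ℝ} {μ : Measure S}

theorem integral_mem_of_mem [IsProbabilityMeasure μ] {f : S → ℝ} (hf : Measurable f)
    (h : ∀ x, 0 ≤ f x ∧ f x ≤ M) : 0 ≤ ∫ x, f x ∂μ ∧ ∫ x, f x ∂μ ≤ M := by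
  refine ⟨integral_nonneg fun x => (h x).1, ?_⟩
  have hi : Integrable f μ :=
    integrable_of_abs_le μ hf fun x => by rw [abs_of_nonneg (h x).1]; exact (h x).2
  simpa using integral_mono hi (integrable_const M) fun x => (h x).2

theorem abs_devSum_le [IsProbabilityMeasure μ] (hum : ∀ h, Measurable (u h))
    (hu : ∀ h x, 0 ≤ u h x ∧ u h x ≤ M) {m : ℕ} (z : Fin m → S) (h : ι) :
    |∑ i, (∫ x, u h x ∂μ - u h (z i))| ≤ m * M := by
  refine abs_sum_le_mul fun i => ?_
  have h1 := integral_mem_of_mem (μ := μ) (hum h) (hu h)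
  have h2 := hu h (z i)
  exact abs_le.2 ⟨by linarith, by linarith⟩

theorem le_devSup [IsProbabilityMeasure μ] (hum : ∀ h, Measurable (u h))
    (hu : ∀ h x, 0 ≤ u h x ∧ u h x ≤ M) {m : ℕ} (z : Fin m → S) (h : ι) :
    ∑ i, (∫ x, u h x ∂μ - u h (z i)) ≤ devSup u μ z :=
  le_ciSup (f := fun h => ∑ i, (∫ x, u h x ∂μ - u h (z i)))
    ⟨m * M, by rintro _ ⟨h, rfl⟩; exact (abs_le.1 (abs_devSum_le hum hu z h)).2⟩ h

theorem abs_devSup_le [Nonempty ι] [IsProbabilityMeasure μ] (hum : ∀ h, Measurable (u h))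
    (hu : ∀ h x, 0 ≤ u h x ∧ u h x ≤ M) {m : ℕ} (z : Fin m → S) : |devSup u μ z| ≤ m * M :=
  abs_ciSup_le fun h => abs_devSum_le hum hu z h

theorem devSup_le_update_add [Nonempty ι] [IsProbabilityMeasure μ] (hum : ∀ h, Measurable (u h))
    (hu : ∀ h x, 0 ≤ u h x ∧ u h x ≤ M) {m : ℕ} (i : Fin m) (z : Fin m → S) (y : S) :
    devSup u μ z ≤ devSup u μ (Function.update z i y) + M := by
  refine ciSup_le fun h => ?_
  refine le_trans ?_ (add_le_add_left (le_devSup hum hu (Function.update z i y) h) M)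
  rw [← Finset.add_sum_erase _ _ (Finset.mem_univ i),
    ← Finset.add_sum_erase (a := i) _ (fun j => ∫ x, u h x ∂μ - u h (Function.update z i y j))
      (Finset.mem_univ i)]
  have : ∑ j ∈ Finset.univ.erase i, (∫ x, u h x ∂μ - u h (Function.update z i y j)) =
      ∑ j ∈ Finset.univ.erase i, (∫ x, u h x ∂μ - u h (z j)) :=
    Finset.sum_congr rfl fun j hj => by rw [Function.update_of_ne (Finset.ne_of_mem_erase hj)]
  rw [this, Function.update_self]
  have h1 := hu h (z i)
  have h2 := hu h y
  linarith

/-- Symmetrization for one sign vector. -/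
theorem upperExpectation_devSup_le_add [Nonempty ι] [IsProbabilityMeasure μ]
    (hum : ∀ h, Measurable (u h)) (hu : ∀ h x, 0 ≤ u h x ∧ u h x ≤ M) {m : ℕ} (σ : Fin m → ℤˣ) :
    upperExpectation (Measure.pi fun _ : Fin m => μ) (devSup u μ) ≤
      upperExpectation (Measure.pi fun _ : Fin m => μ) (signSup u σ) +
        upperExpectation (Measure.pi fun _ : Fin m => μ) (signSup u (-σ)) := by
  set ν := Measure.pi fun _ : Fin m => μ with hν
  obtain ⟨g₁, hm₁, hf₁, hB₁, hi₁, -⟩ := exists_measurable_cover ν (abs_signSup_le hu σ)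
  obtain ⟨g₂, hm₂, hf₂, hB₂, hi₂, -⟩ := exists_measurable_cover ν (abs_signSup_le hu (-σ))
  have hmp₁ : MeasurePreserving _ (ν.prod ν) ν := measurePreserving_signMix μ σ
  have hmp₂ : MeasurePreserving _ (ν.prod ν) ν := measurePreserving_signMix μ (-σ)
  -- Integrating `G` over the ghost sample `w` yields the integrable majorant of `devSup` that
  -- bounds its upper expectation.
  set G : (Fin m → S) × (Fin m → S) → ℝ :=
    fun p => g₁ (signMix σ p.1 p.2) + g₂ (signMix (-σ) p.1 p.2) with hG
  have hGm : Measurable G := (hm₁.comp hmp₁.measurable).add (hm₂.comp hmp₂.measurable)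
  have hGB : ∀ p, |G p| ≤ m * M + m * M := fun p =>
    (abs_add_le _ _).trans (add_le_add (hB₁ _) (hB₂ _))
  have hGi : Integrable G (ν.prod ν) := integrable_of_abs_le _ hGm hGB
  have hGint : ∫ p, G p ∂(ν.prod ν) = ∫ z, g₁ z ∂ν + ∫ z, g₂ z ∂ν := by
    have hi₁ : Integrable (fun p : (Fin m → S) × (Fin m → S) => g₁ (signMix σ p.1 p.2))
        (ν.prod ν) := integrable_of_abs_le _ (hm₁.comp hmp₁.measurable) fun _ => hB₁ _
    have hi₂ : Integrable (fun p : (Fin m → S) × (Fin m → S) => g₂ (signMix (-σ) p.1 p.2))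
        (ν.prod ν) := integrable_of_abs_le _ (hm₂.comp hmp₂.measurable) fun _ => hB₂ _
    simp only [hG]
    rw [integral_add hi₁ hi₂]
    congr 1
    · conv_rhs => rw [← hmp₁.map_eq, integral_map hmp₁.measurable.aemeasurable
        hm₁.aestronglyMeasurable]
    · conv_rhs => rw [← hmp₂.map_eq, integral_map hmp₂.measurable.aemeasurable
        hm₂.aestronglyMeasurable]
  rw [← hi₁, ← hi₂, ← hGint, integral_prod _ hGi]
  refine upperExpectation_le ν (fun z => (abs_le.1 (abs_devSup_le hum hu z)).1)
    hGi.integral_prod_left fun z => ciSup_le fun h => ?_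
  have huc : ∀ i, Integrable (fun w : Fin m → S => u h (w i)) ν := fun i =>
    integrable_of_abs_le (B := M) _ ((hum h).comp (measurable_pi_apply i)) fun w => by
      rw [abs_of_nonneg (hu h _).1]; exact (hu h _).2
  have hE : ∀ i, ∫ w, u h (w i) ∂ν = ∫ x, u h x ∂μ := fun i => by
    have := measurePreserving_eval (fun _ : Fin m => μ) i
    conv_rhs => rw [← this.map_eq, integral_map this.measurable.aemeasurable
      (hum h).aestronglyMeasurable]
  have hud : ∀ i, Integrable (fun w : Fin m → S => u h (w i) - u h (z i)) ν := fun i =>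
    (huc i).sub (integrable_const _)
  calc ∑ i, (∫ x, u h x ∂μ - u h (z i)) = ∫ w, ∑ i, (u h (w i) - u h (z i)) ∂ν := by
        rw [integral_finsetSum _ fun i _ => hud i]
        refine Finset.sum_congr rfl fun i _ => ?_
        rw [integral_sub (huc i) (integrable_const _), hE]
        simp
    _ ≤ ∫ w, G (z, w) ∂ν := by
        refine integral_mono (integrable_finsetSum _ fun i _ => hud i)
          (integrable_of_abs_le _ (hGm.comp (measurable_const.prodMk measurable_id))
            fun w => hGB _) fun w => ?_
        simp only
        rw [sum_sub_eq_signMix (u h) σ z w]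
        exact add_le_add ((le_signSup hu σ _ h).trans (hf₁ _))
          ((le_signSup hu (-σ) _ h).trans (hf₂ _))

/-- The average over all sign vectors of the upper expectations of `signSup`. -/
noncomputable def signAverage (u : ι → S → ℝ) (μ : Measure S) (m : ℕ) : ℝ :=
  (1 / (2 : ℝ) ^ m) * ∑ σ : Fin m → ℤˣ,
    upperExpectation (Measure.pi fun _ : Fin m => μ) (signSup u σ)

theorem card_signs (m : ℕ) : (Finset.univ : Finset (Fin m → ℤˣ)).card = 2 ^ m := by
  simp [Finset.card_univ]

/-- Averaging over `σ` makes both terms equal, since `σ ↦ -σ` permutes the sign vectors. -/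
theorem le_two_mul_signAverage {m : ℕ} {r : ℝ}
    (h : ∀ σ : Fin m → ℤˣ, r ≤ upperExpectation (Measure.pi fun _ : Fin m => μ) (signSup u σ) +
      upperExpectation (Measure.pi fun _ : Fin m => μ) (signSup u (-σ))) :
    r ≤ 2 * signAverage u μ m := by
  have h1 := Finset.sum_le_sum fun σ (_ : σ ∈ Finset.univ) => h σ
  have h2 := Equiv.sum_comp (Equiv.neg (Fin m → ℤˣ)) fun σ =>
      upperExpectation (Measure.pi fun _ : Fin m => μ) (signSup u σ)
  simp only [Equiv.neg_apply] at h2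
  rw [Finset.sum_const, card_signs, Finset.sum_add_distrib, h2] at h1
  rw [nsmul_eq_mul] at h1
  push_cast at h1
  rw [signAverage, one_div, ← mul_assoc, mul_comm 2, mul_assoc, ← div_eq_inv_mul,
    le_div_iff₀ (by positivity)]
  linarith

theorem upperExpectation_devSup_le [Nonempty ι] [IsProbabilityMeasure μ]
    (hum : ∀ h, Measurable (u h)) (hu : ∀ h x, 0 ≤ u h x ∧ u h x ≤ M) (m : ℕ) :
    upperExpectation (Measure.pi fun _ : Fin m => μ) (devSup u μ) ≤ 2 * signAverage u μ m :=
  le_two_mul_signAverage fun σ => upperExpectation_devSup_le_add hum hu σ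

/-- For a single index `h` the signed sums for `σ` and `-σ` cancel, and each supremum dominates the
corresponding sum. -/
theorem signAverage_nonneg [Nonempty ι] [IsProbabilityMeasure μ]
    (hum : ∀ h, Measurable (u h)) (hu : ∀ h x, 0 ≤ u h x ∧ u h x ≤ M) (m : ℕ) :
    0 ≤ signAverage u μ m := by
  have : (0 : ℝ) ≤ 2 * signAverage u μ m := by
    refine le_two_mul_signAverage fun σ => ?_
    obtain ⟨h⟩ := ‹Nonempty ι›
    have key : ∀ σ : Fin m → ℤˣ, ∫ z, ∑ i, ((σ i : ℤ) : ℝ) * u h (z i)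
        ∂(Measure.pi fun _ : Fin m => μ) ≤
          upperExpectation (Measure.pi fun _ : Fin m => μ) (signSup u σ) := by
      intro σ
      have : Nonempty ι := ⟨h⟩
      obtain ⟨g, hm, hf, hB, hi, -⟩ :=
        exists_measurable_cover (Measure.pi fun _ : Fin m => μ) (abs_signSup_le hu σ)
      rw [← hi]
      refine integral_mono ?_ (integrable_of_abs_le _ hm hB) fun z =>
        (le_signSup hu σ z h).trans (hf z)
      refine integrable_of_abs_le _ ?_ fun z => abs_signSum_le hu σ z h
      exact Finset.measurable_sum _ fun i _ =>
        ((hum h).comp (measurable_pi_apply i)).const_mul _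
    refine le_trans (le_of_eq ?_) (add_le_add (key σ) (key (-σ)))
    have : ∀ z : Fin m → S, ∑ i, (((-σ) i : ℤ) : ℝ) * u h (z i) =
        -∑ i, ((σ i : ℤ) : ℝ) * u h (z i) := fun z => by simp
    simp_rw [this, integral_neg]
    ring
  linarith

/-- Uniform deviation bound for an independent sample: outside a measurable set of small measure,
all deviations are at most twice the symmetrized average, up to `m * M * s`. -/
theorem exists_exceptional_set [Nonempty ι] [IsProbabilityMeasure μ] (hM : 0 < M)
    (hum : ∀ h, Measurable (u h)) (hu : ∀ h x, 0 ≤ u h x ∧ u h x ≤ M) (m : ℕ) {s : ℝ}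
    (hs : 0 ≤ s) :
    ∃ B : Set (Fin m → S), MeasurableSet B ∧
      (Measure.pi fun _ : Fin m => μ) B ≤ ENNReal.ofReal (Real.exp (-(m * s ^ 2 / 2))) ∧
      ∀ z ∉ B, ∀ h, ∑ i, (∫ x, u h x ∂μ - u h (z i)) ≤ 2 * signAverage u μ m + m * M * s := by
  obtain ⟨g, hm, hf, hB, hi, hmin⟩ :=
    exists_measurable_cover (Measure.pi fun _ : Fin m => μ) (abs_devSup_le (μ := μ) hum hu)
  -- Cutting at a level of the cover `g` instead of `devSup` makes the set measurable, as the
  -- comparison of laws requires.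
  refine ⟨{z | ∫ z, g z ∂(Measure.pi fun _ => μ) + m * M * s ≤ g z},
    measurableSet_le measurable_const hm,
    measure_ge_le_of_bounded_differences μ hM hs hm hB
      (ae_ae_le_update_add μ hm hB hf hmin (devSup_le_update_add hum hu)), fun z hz h => ?_⟩
  have h1 := (le_devSup (μ := μ) hum hu z h).trans (hf z)
  have h2 := upperExpectation_devSup_le (μ := μ) hum hu m
  simp only [Set.mem_ofPred_eq, not_le, hi] at hz
  linarith

end Symmetrization

/-! ### Replacing combs by independent samples -/

section Decoupling

variable {Ω S : Type*} [MeasurableSpace Ω] [MeasurableSpace S]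

theorem measure_le_add_tvDist (μ ν : Measure S) [IsFiniteMeasure μ] [IsFiniteMeasure ν] {B : Set S}
    (hB : MeasurableSet B) : μ B ≤ ν B + tvDist μ ν := by
  have h : ENNReal.ofReal |μ.real B - ν.real B| ≤ tvDist μ ν :=
    le_iSup₂ (f := fun (B : Set S) (_ : MeasurableSet B) =>
      ENNReal.ofReal |μ.real B - ν.real B|) B hB
  refine le_trans ?_ (add_le_add_right h _)
  rw [← ofReal_measureReal (μ := μ), ← ofReal_measureReal (μ := ν),
    ← ENNReal.ofReal_add measureReal_nonneg (abs_nonneg _)]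
  refine ENNReal.ofReal_le_ofReal ?_
  linarith [le_abs_self (μ.real B - ν.real B)]

theorem measurable_past {Z : ℤ → Ω → S} (hZ : ∀ t, Measurable (Z t)) (t : ℤ) :
    Measurable (past Z t) :=
  measurable_pi_iff.2 fun s => hZ s

variable [StandardBorelSpace S] [Nonempty S]

/-- Replacing `Z (t + a)` by an independent variable of law `Pi` changes probabilities of events
that depend on it and on the past up to time `t` by at most `β(a)`. -/
theorem measure_prodMk_le_add_betaCoeff (P : Measure Ω) [IsProbabilityMeasure P] {Z : ℤ → Ω → S}
    (hZ : ∀ t, Measurable (Z t)) (Pi : Measure S) [IsProbabilityMeasure Pi] {E : Type*}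
    [MeasurableSpace E] {t : ℤ} (ht : 1 ≤ t) (a : ℕ) {w : (Set.Iic t → S) → E} (hw : Measurable w)
    {B : Set (S × E)} (hB : MeasurableSet B) :
    P.map (fun ω => (Z (t + a) ω, w (past Z t ω))) B ≤
      (Pi.prod (P.map fun ω => w (past Z t ω))) B + betaCoeff P Z Pi a := by
  have hp := measurable_past hZ t
  have hwp : Measurable fun ω => w (past Z t ω) := hw.comp hp
  set k := condDistrib (Z (t + a)) (past Z t) P with hk
  set B' : Set ((Set.Iic t → S) × S) := {q | (q.2, w q.1) ∈ B} with hB'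
  have hBm' : MeasurableSet B' :=
    (measurable_snd.prodMk (hw.comp measurable_fst)) hB
  have h1 : P.map (fun ω => (Z (t + a) ω, w (past Z t ω))) B =
      ∫⁻ ω, k (past Z t ω) (Prod.mk (past Z t ω) ⁻¹' B') ∂P := by
    have hj := compProd_map_condDistrib (mβ := MeasurableSpace.pi) (X := past Z t) (μ := P)
      (hZ (t + a)).aemeasurable
    rw [Measure.map_apply ((hZ _).prodMk hwp) hB]
    calc _ = P.map (fun ω => (past Z t ω, Z (t + a) ω)) B' := by
          rw [Measure.map_apply (hp.prodMk (hZ _)) hBm']; rfl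
      _ = _ := by
          rw [← hj, Measure.compProd_apply hBm',
            lintegral_map (Kernel.measurable_kernel_prodMk_left hBm') hp]
  have hBw : Measurable fun e : E => Pi ((fun y => (y, e)) ⁻¹' B) :=
    measurable_measure_prodMk_right hB
  have h2 : (Pi.prod (P.map fun ω => w (past Z t ω))) B =
      ∫⁻ ω, Pi ((fun y => (y, w (past Z t ω))) ⁻¹' B) ∂P := by
    have : IsProbabilityMeasure (P.map fun ω => w (past Z t ω)) :=
      Measure.isProbabilityMeasure_map hwp.aemeasurable
    rw [Measure.prod_apply_symm hB, lintegral_map hBw hwp]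
  rw [h1, h2]
  calc _ ≤ ∫⁻ ω, (Pi ((fun y => (y, w (past Z t ω))) ⁻¹' B) + tvDist (k (past Z t ω)) Pi) ∂P :=
        lintegral_mono fun ω => measure_le_add_tvDist _ _ (measurable_prodMk_right hB)
    -- Only the first summand has to be measurable; `tvDist` is a supremum over possibly uncountably
    -- many sets.
    _ = _ := lintegral_add_left (hBw.comp hwp) _
    _ ≤ _ := add_le_add_right
        (le_iSup₂ (f := fun (t : ℤ) (_ : 1 ≤ t) => ∫⁻ ω : Ω,
          tvDist (condDistrib (Z (t + (a : ℤ))) (past Z t) P (past Z t ω)) Pi ∂P) t ht) _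

/-- The law of a sample with gaps `a` is within `m β(a)` of the product law. -/
theorem measure_map_comb_le (P : Measure Ω) [IsProbabilityMeasure P] {Z : ℤ → Ω → S}
    (hZ : ∀ t, Measurable (Z t)) (Pi : Measure S) [IsProbabilityMeasure Pi] (a : ℕ) {j : ℤ}
    (hj : 1 ≤ j) :
    ∀ (m : ℕ) {B : Set (Fin m → S)}, MeasurableSet B →
      P.map (fun ω (i : Fin m) => Z (j + ((i : ℕ) + 1) * a) ω) B ≤
        (Measure.pi fun _ => Pi) B + m * betaCoeff P Z Pi a
  | 0, B, hB => by
      have : P.map (fun ω (i : Fin 0) => Z (j + ((i : ℕ) + 1) * a) ω) =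
          Measure.pi fun _ : Fin 0 => Pi := by
        rw [Measure.pi_of_empty (fun _ : Fin 0 => Pi) Fin.elim0]
        ext B hB
        rw [Measure.map_apply (measurable_pi_iff.2 fun i => i.elim0) hB, Measure.dirac_apply' _ hB]
        by_cases h : (Fin.elim0 : Fin 0 → S) ∈ B
        · have : ((fun ω (i : Fin 0) => Z (j + ((i : ℕ) + 1) * a) ω) ⁻¹' B) = Set.univ := by
            ext ω
            simp only [Set.mem_preimage, Set.mem_univ, iff_true]
            convert h
          rw [this]; simp [h]
        · have : ((fun ω (i : Fin 0) => Z (j + ((i : ℕ) + 1) * a) ω) ⁻¹' B) = ∅ := by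
            ext ω
            simp only [Set.mem_preimage, Set.mem_empty_iff_false, iff_false]
            convert h
          rw [this]; simp [h]
      rw [this]
      exact le_self_add
  | m + 1, B, hB => by
      set e := MeasurableEquiv.piFinSuccAbove (fun _ : Fin (m + 1) => S) (Fin.last m) with he
      have hmp : MeasurePreserving e (Measure.pi fun _ => Pi)
          (Pi.prod (Measure.pi fun _ : Fin m => Pi)) :=
        measurePreserving_piFinSuccAbove (fun _ : Fin (m + 1) => Pi) (Fin.last m)
      have hBe : MeasurableSet (e.symm ⁻¹' B) := e.symm.measurable hB
      -- `t` lies one gap before the last point, and all earlier points are in its past. Since the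
      -- comb starts at `j + a`, even its first point has a conditioning time `j ≥ 1`.
      set t : ℤ := j + m * a with ht
      have ht1 : 1 ≤ t := by
        have : (0 : ℤ) ≤ m * a := by positivity
        omega
      have hle : ∀ i : Fin m, j + ((i : ℕ) + 1) * (a : ℤ) ≤ t := fun i => by
        have h1 : ((i : ℕ) + 1 : ℤ) ≤ m := by exact_mod_cast i.2
        have h2 : (0 : ℤ) ≤ a := by positivity
        have := mul_le_mul_of_nonneg_right h1 h2
        omega
      set w : (Set.Iic t → S) → Fin m → S := fun x i => x ⟨j + ((i : ℕ) + 1) * a, hle i⟩ with hw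
      have hwm : Measurable w := measurable_pi_iff.2 fun i => measurable_pi_apply _
      have hta : t + a = j + ((m : ℤ) + 1) * a := by rw [ht]; ring
      have hwpm : Measurable fun ω => w (past Z t ω) := hwm.comp (measurable_past hZ t)
      have hWm : ∀ n, Measurable fun ω (i : Fin n) => Z (j + ((i : ℕ) + 1) * a) ω := fun n =>
        measurable_pi_iff.2 fun i => hZ _
      have heq : ∀ ω, e (fun i : Fin (m + 1) => Z (j + ((i : ℕ) + 1) * a) ω) =
          (Z (t + a) ω, w (past Z t ω)) := fun ω => by
        rw [hta]
        ext i
        · simp [he, MeasurableEquiv.piFinSuccAbove, Fin.insertNthEquiv]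
        · simp [he, MeasurableEquiv.piFinSuccAbove, Fin.insertNthEquiv, Fin.init, hw, past]
      have h1 : P.map (fun ω (i : Fin (m + 1)) => Z (j + ((i : ℕ) + 1) * a) ω) B =
          P.map (fun ω => (Z (t + a) ω, w (past Z t ω))) (e.symm ⁻¹' B) := by
        rw [Measure.map_apply (hWm _) hB,
          Measure.map_apply ((hZ _).prodMk hwpm) hBe]
        congr 1
        ext ω
        simp only [Set.mem_preimage]
        rw [← heq, MeasurableEquiv.symm_apply_apply]
      have h2 : (Measure.pi fun _ => Pi) B =
          (Pi.prod (Measure.pi fun _ : Fin m => Pi)) (e.symm ⁻¹' B) := by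
        rw [← hmp.map_eq, Measure.map_apply e.measurable hBe, ← Set.preimage_comp]
        simp
      rw [h1, h2]
      refine (measure_prodMk_le_add_betaCoeff P hZ Pi ht1 a hwm hBe).trans ?_
      have hwp : (fun ω => w (past Z t ω)) = fun ω (i : Fin m) => Z (j + ((i : ℕ) + 1) * a) ω := rfl
      rw [hwp, Nat.cast_succ, add_mul, one_mul, ← add_assoc]
      gcongr
      have : IsProbabilityMeasure (P.map fun ω (i : Fin m) => Z (j + ((i : ℕ) + 1) * a) ω) :=
        Measure.isProbabilityMeasure_map (hWm m).aemeasurable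
      rw [Measure.prod_apply hBe, Measure.prod_apply hBe]
      calc _ ≤ ∫⁻ y, ((Measure.pi fun _ : Fin m => Pi) (Prod.mk y ⁻¹' (e.symm ⁻¹' B)) +
              m * betaCoeff P Z Pi a) ∂Pi :=
            lintegral_mono fun y =>
              measure_map_comb_le P hZ Pi a hj m (measurable_prodMk_left hBe)
        _ = _ := by rw [lintegral_add_right _ measurable_const]; simp

end Decoupling

/-! ### From combs to the full average -/

section Blocks

theorem sum_range_mul_eq (g : ℕ → ℝ) (m a : ℕ) :
    ∑ n ∈ Finset.range (m * a), g n = ∑ j ∈ Finset.range a, ∑ i : Fin m, g (j + i * a) := by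
  rw [Finset.sum_comm]
  simp_rw [Fin.sum_univ_eq_sum_range (fun i => ∑ j ∈ Finset.range a, g (j + i * a)) m]
  induction m with
  | zero => simp
  | succ m ih =>
    rw [Nat.succ_mul, Finset.sum_range_add, ih, Finset.sum_range_succ]
    simp only [add_comm]

theorem sum_Icc_one_eq (g : ℕ → ℝ) (T : ℕ) :
    ∑ t ∈ Finset.Icc 1 T, g t = ∑ n ∈ Finset.range T, g (n + 1) := by
  rw [Finset.range_eq_Ico, Finset.sum_Ico_add' g 0 T 1]
  rfl

/-- Bounds along all subsequences with gap `a` give a bound for the full average. -/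
theorem le_average_of_comb_le {g : ℕ → ℝ} {M E r : ℝ} {T m a : ℕ} (hT : 0 < T)
    (hg : ∀ n, 0 ≤ g n ∧ g n ≤ M) (hE : E ≤ M) (hr : 0 ≤ r) (h1 : m * a ≤ T)
    (h2 : T < (m + 1) * a)
    (h : ∀ j ∈ Finset.range a, ∑ i : Fin m, (E - g (j + 1 + (i + 1) * a)) ≤ m * r) :
    E ≤ (1 / (T : ℝ)) * ∑ t ∈ Finset.Icc 1 T, g t + r + 2 * (a * M / T) := by
  have hT' : (0 : ℝ) < T := by exact_mod_cast hT
  have hM : 0 ≤ M := (hg 0).1.trans (hg 0).2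
  have hsum := Finset.sum_le_sum h
  have hlhs : ∑ j ∈ Finset.range a, ∑ i : Fin m, (E - g (j + 1 + (i + 1) * a)) =
      m * a * E - ∑ n ∈ Finset.range (m * a), g (a + n + 1) := by
    rw [sum_range_mul_eq (fun n => g (a + n + 1))]
    simp_rw [Finset.sum_sub_distrib]
    congr 1
    · simp; ring
    · refine Finset.sum_congr rfl fun j _ => Finset.sum_congr rfl fun i _ => ?_
      congr 1; ring
  rw [hlhs, Finset.sum_const, Finset.card_range, nsmul_eq_mul] at hsum
  -- The combs fill the times `a + 1, …, a + m * a`, which overrun `T` by at most `a` terms; each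
  -- costs at most `M`.
  have hshift : ∑ n ∈ Finset.range (m * a), g (a + n + 1) ≤
      ∑ t ∈ Finset.Icc 1 T, g t + a * M := by
    rw [sum_Icc_one_eq]
    have e1 := Finset.sum_range_add (fun n => g (n + 1)) a (m * a)
    have e2 := Finset.sum_range_add (fun n => g (n + 1)) T (a + m * a - T)
    have hlen : T + (a + m * a - T) = a + m * a := by
      have : (m + 1) * a = m * a + a := by ring
      omega
    rw [hlen] at e2
    have p1 : 0 ≤ ∑ n ∈ Finset.range a, g (n + 1) := Finset.sum_nonneg fun n _ => (hg _).1
    have p2 : ∑ n ∈ Finset.range (a + m * a - T), g (T + n + 1) ≤ a * M := by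
      refine (Finset.sum_le_card_nsmul _ _ M fun n _ => (hg _).2).trans ?_
      rw [Finset.card_range, nsmul_eq_mul]
      gcongr
      omega
    linarith
  have c1 : (m : ℝ) * a ≤ T := by exact_mod_cast h1
  have c2 : (T : ℝ) ≤ m * a + a := by
    have : (T : ℝ) < (m + 1) * a := by exact_mod_cast h2
    linarith
  -- The second `a * M` pays for the `T - m * a ≤ a` copies of `E` not matched by a comb point.
  have c3 : (T : ℝ) * E ≤ ∑ t ∈ Finset.Icc 1 T, g t + T * r + 2 * (a * M) := by
    have q1 : (T - (m : ℝ) * a) * E ≤ a * M := by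
      refine (mul_le_mul_of_nonneg_left hE (by linarith)).trans ?_
      exact mul_le_mul_of_nonneg_right (by linarith) hM
    have q2 := mul_le_mul_of_nonneg_right c1 hr
    nlinarith
  have c4 : E ≤ (∑ t ∈ Finset.Icc 1 T, g t + T * r + 2 * (a * M)) / T := by
    rw [le_div_iff₀ hT']; linarith
  refine c4.trans (le_of_eq ?_)
  field_simp

end Blocks

/-! ### Uniform deviation for the dependent sample -/

section UniformDeviation

variable {Ω X Y : Type*} [MeasurableSpace X] [MeasurableSpace Y]

theorem rademacher_eq (L : Y → Y → ℝ) (H : Set (X → Y)) (Pi : Measure (X × Y)) (m : ℕ) :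
    rademacher L H Pi m = (1 / (m : ℝ)) * signAverage (fun h : H => lossAt L (h : X → Y)) Pi m :=
  rfl

variable {L : Y → Y → ℝ} {H : Set (X → Y)} {M : ℝ}

theorem rademacher_nonneg (Pi : Measure (X × Y)) [IsProbabilityMeasure Pi] (hH : H.Nonempty)
    (hL : ∀ y y', 0 ≤ L y y' ∧ L y y' ≤ M) (hm : ∀ h ∈ H, Measurable (lossAt L h)) (m : ℕ) :
    0 ≤ rademacher L H Pi m := by
  rw [rademacher_eq]
  have : Nonempty H := hH.to_subtype
  exact mul_nonneg (by positivity)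
    (signAverage_nonneg (u := fun h : H => lossAt L (h : X → Y)) (M := M) (fun h => hm h h.2)
      (fun h x => hL _ _) m)

/-- This settles the trivial regime: a remainder of size `M` already exceeds any expected loss, and
the other terms are nonnegative. -/
theorem forall_le_of_bound_le (Z : ℤ → Ω → X × Y) (Pi : Measure (X × Y))
    [IsProbabilityMeasure Pi] (hL : ∀ y y', 0 ≤ L y y' ∧ L y y' ≤ M)
    (hm : ∀ h ∈ H, Measurable (lossAt L h)) (T m : ℕ) {r : ℝ} (hr : M ≤ r) (ω : Ω) :
    ∀ h ∈ H, expectedLoss L Pi h ≤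
      empiricalLoss L Z T h ω + 2 * rademacher L H Pi m + r := by
  intro h hh
  have h1 : expectedLoss L Pi h ≤ M :=
    (integral_mem_of_mem (hm h hh) fun x => hL _ _).2
  have h2 : 0 ≤ empiricalLoss L Z T h ω :=
    mul_nonneg (by positivity) (Finset.sum_nonneg fun t _ => (hL _ _).1)
  have h3 := rademacher_nonneg Pi ⟨h, hh⟩ hL hm m
  linarith

variable [MeasurableSpace Ω] [StandardBorelSpace X] [Nonempty X] [StandardBorelSpace Y] [Nonempty Y]

/-- Uniform deviation bound for a dependent sample, with explicit block length `a` and explicit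
probability of failure. -/
theorem measure_not_forall_le (P : Measure Ω) [IsProbabilityMeasure P] {Z : ℤ → Ω → X × Y}
    (hZ : ∀ t, Measurable (Z t)) (Pi : Measure (X × Y)) [IsProbabilityMeasure Pi] (hM : 0 < M)
    (hL : ∀ y y', 0 ≤ L y y' ∧ L y y' ≤ M) (hm : ∀ h ∈ H, Measurable (lossAt L h)) {T m a : ℕ}
    (hm0 : 0 < m) (hT : 0 < T) (h1 : m * a ≤ T) (h2 : T < (m + 1) * a) {s : ℝ} (hs : 0 ≤ s) :
    P {ω | ¬ ∀ h ∈ H, expectedLoss L Pi h ≤ empiricalLoss L Z T h ω + 2 * rademacher L H Pi m +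
        M * (s + 2 * (a / T))} ≤
      a * (ENNReal.ofReal (Real.exp (-(m * s ^ 2 / 2))) + m * betaCoeff P Z Pi a) := by
  rcases H.eq_empty_or_nonempty with rfl | hH
  · simp
  have : Nonempty H := hH.to_subtype
  have hm' : (0 : ℝ) < m := by exact_mod_cast hm0
  -- One exceptional set, built for the product law, serves all `a` combs.
  obtain ⟨B, hBm, hB, hdev⟩ := exists_exceptional_set (μ := Pi) hM
    (u := fun h : H => lossAt L (h : X → Y)) (fun h => hm h h.2) (fun h x => hL _ _) m hs
  set W : ℕ → Ω → Fin m → X × Y := fun j ω i => Z (((j : ℕ) + 1 : ℤ) + ((i : ℕ) + 1) * a) ω with hW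
  have hWm : ∀ j, Measurable (W j) := fun j => measurable_pi_iff.2 fun i => hZ _
  have hsub : {ω | ¬ ∀ h ∈ H, expectedLoss L Pi h ≤ empiricalLoss L Z T h ω +
      2 * rademacher L H Pi m + M * (s + 2 * (a / T))} ⊆
        ⋃ j ∈ Finset.range a, W j ⁻¹' B := by
    intro ω hω
    by_contra hcon
    refine hω fun h hh => ?_
    simp only [Set.mem_iUnion, Set.mem_preimage, not_exists] at hcon
    have hR := rademacher_nonneg Pi hH hL hm m
    have key := le_average_of_comb_le (g := fun n : ℕ => lossAt L h (Z n ω)) (M := M)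
      (E := expectedLoss L Pi h) (r := 2 * rademacher L H Pi m + M * s) hT (fun n => hL _ _)
      (integral_mem_of_mem (hm h hh) fun x => hL _ _).2 (by positivity) h1 h2 fun j hj => by
        have := hdev _ (hcon j hj) ⟨h, hh⟩
        rw [rademacher_eq]
        calc _ = _ := ?_
          _ ≤ _ := this
          _ = _ := by field_simp
        refine Finset.sum_congr rfl fun i _ => ?_
        simp only [hW, expectedLoss]
        push_cast
        rfl
    refine key.trans (le_of_eq ?_)
    simp only [empiricalLoss]
    ring
  refine (measure_mono hsub).trans ((measure_biUnion_finset_le _ _).trans ?_)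
  refine (Finset.sum_le_card_nsmul _ _
    (ENNReal.ofReal (Real.exp (-(m * s ^ 2 / 2))) + m * betaCoeff P Z Pi a) fun j _ => ?_).trans ?_
  · have := measure_map_comb_le P hZ Pi a (j := (j : ℤ) + 1) (by omega) m hBm
    rw [Measure.map_apply (hWm j) hBm] at this
    exact this.trans (by gcongr)
  · rw [Finset.card_range, nsmul_eq_mul]

end UniformDeviation

/-! ### Choice of the deviation level -/

section Rates

/-- The failure probability is at most `T ^ (-p)` for block lengths of order `log T`. -/
theorem failure_probability_le {C d p κ A : ℝ} {T m a : ℕ} (hC : 0 < C) (hd : 0 < d) (hA : 0 < A)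
    (hp : 0 < p) (hκ : (1 + p) / d < κ) (hT : 2 ≤ T) (hm : 0 < m) (h1 : m * a ≤ T)
    (h2 : T < (m + 1) * a) (ha : κ * Real.log T ≤ a) (ha' : a ≤ A * Real.log T)
    (hbig : (2 * C) ^ (1 / (d * κ - 1 - p)) ≤ (T : ℝ)) :
    a * (Real.exp (-(m * (2 * √(A * (p + 2)) * (Real.log T / √T)) ^ 2 / 2)) +
      m * (C * Real.exp (-d * a))) ≤ (T : ℝ) ^ (-p) := by
  have hT' : (2 : ℝ) ≤ T := by exact_mod_cast hT
  have hT0 : (0 : ℝ) < T := by linarith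
  have hm1 : (1 : ℝ) ≤ m := by exact_mod_cast hm
  have hlog : 0 < Real.log T := Real.log_pos (by linarith)
  have hη : 0 < d * κ - 1 - p := by
    rw [div_lt_iff₀ hd] at hκ; linarith
  have hκ0 : 0 < κ := lt_trans (by positivity) hκ
  have ha0 : (0 : ℝ) < a := lt_of_lt_of_le (by positivity) ha
  have hma : (m : ℝ) * a ≤ T := by exact_mod_cast h1
  have hma2 : (T : ℝ) < (m + 1) * a := by exact_mod_cast h2
  have haT : (a : ℝ) ≤ T := by nlinarith
  have hexp : ∀ x : ℝ, Real.exp (x * Real.log T) = (T : ℝ) ^ x := fun x => by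
    rw [Real.rpow_def_of_pos hT0, mul_comm]
  have hTp : (0 : ℝ) < (T : ℝ) ^ (-p) := by positivity
  have e1 : a * Real.exp (-(m * (2 * √(A * (p + 2)) * (Real.log T / √T)) ^ 2 / 2)) ≤
      (T : ℝ) ^ (-p) / 2 := by
    have hsq : (2 * √(A * (p + 2)) * (Real.log T / √T)) ^ 2 =
        4 * (A * (p + 2)) * (Real.log T ^ 2 / T) := by
      rw [mul_pow, mul_pow, div_pow, Real.sq_sqrt (by positivity), Real.sq_sqrt hT0.le]; norm_num
    have hexponent : (p + 2) * Real.log T ≤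
        m * (2 * √(A * (p + 2)) * (Real.log T / √T)) ^ 2 / 2 := by
      rw [hsq]
      have : m * (4 * (A * (p + 2)) * (Real.log T ^ 2 / T)) / 2 =
          ((p + 2) * Real.log T) * ((2 * m * (A * Real.log T)) / T) := by
        field_simp; ring
      rw [this]
      refine le_mul_of_one_le_right (by positivity) ?_
      rw [one_le_div hT0]
      -- Since `m ≥ 1`, `2 * m * a ≥ (m + 1) * a > T`.
      have : 2 * m * (a : ℝ) ≤ 2 * m * (A * Real.log T) := by gcongr
      nlinarith
    -- Of the exponent `p + 2`, one unit absorbs the factor `a ≤ T` and one leaves `1 / T ≤ 1 / 2`.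
    calc a * Real.exp (-(m * (2 * √(A * (p + 2)) * (Real.log T / √T)) ^ 2 / 2))
        ≤ T * Real.exp (-(p + 2) * Real.log T) := by
          gcongr
          linarith
      _ = (T : ℝ) ^ (-p) / T := by
          rw [hexp, show -(p + 2) = -p - 1 - 1 by ring, Real.rpow_sub_one hT0.ne',
            Real.rpow_sub_one hT0.ne']
          field_simp
      _ ≤ _ := by gcongr
  have e2 : a * (m * (C * Real.exp (-d * a))) ≤ (T : ℝ) ^ (-p) / 2 := by
    -- The margin `d * κ - 1 - p > 0` is what lets large `T` absorb the constant `C`.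
    have hC2 : 2 * C ≤ (T : ℝ) ^ (d * κ - 1 - p) := by
      have := Real.rpow_le_rpow (by positivity) hbig hη.le
      rwa [← Real.rpow_mul (by positivity), one_div_mul_cancel hη.ne', Real.rpow_one] at this
    calc a * (m * (C * Real.exp (-d * a))) = (m * a) * (C * Real.exp (-d * a)) := by ring
      _ ≤ T * (C * Real.exp (-(d * κ) * Real.log T)) := by
          have := mul_le_mul_of_nonneg_left ha hd.le
          have : -d * a ≤ -(d * κ) * Real.log T := by linarith
          gcongr
      _ = (T : ℝ) ^ (-p) * (C / (T : ℝ) ^ (d * κ - 1 - p)) := by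
          rw [hexp, show -(d * κ) = -p - (d * κ - 1 - p) - 1 by ring, Real.rpow_sub_one hT0.ne',
            Real.rpow_sub hT0]
          field_simp
      _ ≤ (T : ℝ) ^ (-p) * (1 / 2) := by
          refine mul_le_mul_of_nonneg_left ?_ hTp.le
          rw [div_le_div_iff₀ (by positivity) (by norm_num)]
          linarith
      _ = _ := by ring
  rw [mul_add]
  linarith

end Rates

end TemporalBound

/-! ### The theorem -/

theorem mainTheorem1 (C d p κ A : ℝ) (hC : 0 < C) (hd : 0 < d) (hp : 0 < p)
    (hκ : (1 + p) / d < κ) :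
    ∃ K : ℝ, 0 < K ∧
      ∀ (Ω : Type*) [MeasurableSpace Ω] (P : Measure Ω) [IsProbabilityMeasure P]
        (X : Type*) [MeasurableSpace X] [StandardBorelSpace X] [Nonempty X]
        (Y : Type*) [MeasurableSpace Y] [StandardBorelSpace Y] [Nonempty Y]
        (Z : ℤ → Ω → X × Y) (_ : ∀ t, Measurable (Z t))
        (Pi : Measure (X × Y)) [IsProbabilityMeasure Pi]
        (_ : TemporalBound.ExpBetaMixing P Z Pi C d)
        (M : ℝ) (L : Y → Y → ℝ) (_ : ∀ y y', 0 ≤ L y y' ∧ L y y' ≤ M)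
        (H : Set (X → Y)) (_ : ∀ h ∈ H, Measurable (TemporalBound.lossAt L h))
        (T m a : ℕ) (_ : 2 ≤ T) (_ : m * a ≤ T) (_ : T < (m + 1) * a)
        (_ : κ * Real.log T ≤ a) (_ : a ≤ A * Real.log T),
        P {ω | ¬ ∀ h ∈ H,
            TemporalBound.expectedLoss L Pi h ≤
              TemporalBound.empiricalLoss L Z T h ω
                + 2 * TemporalBound.rademacher L H Pi m
                + K * M * (Real.log T / Real.sqrt T)}
          ≤ ENNReal.ofReal ((T : ℝ) ^ (-p)) := by
  set T₀ : ℝ := (2 * C) ^ (1 / (d * κ - 1 - p)) with hT₀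
  have hT₀0 : 0 < T₀ := by positivity
  have hκ0 : 0 < κ := lt_trans (by positivity) hκ
  have hlog2 : 0 < Real.log 2 := Real.log_pos (by norm_num)
  -- The first two summands dominate `s` and the boundary error `2 * (a / T)`. Outside the trivial
  -- regime `K * log T < √T ≤ T`, so `A ≤ K` gives `a < T`, hence `m > 0`, and the last summand
  -- gives `T₀ ≤ T`. Absolute values appear because `A > 0` is known only once a block length `a`
  -- exists.
  set K : ℝ := 2 * √(|A| * (p + 2)) + 2 * |A| + |A| + T₀ / Real.log 2 with hK
  have hK0 : 0 < K := by positivity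
  refine ⟨K, hK0, ?_⟩
  intro Ω _ P _ X _ _ _ Y _ _ _ Z hZ Pi _ hmix M L hL H hm T m a hT h1 h2 ha ha'
  have hT' : (2 : ℝ) ≤ T := by exact_mod_cast hT
  have hT0 : (0 : ℝ) < T := by linarith
  have hlog : 0 < Real.log T := Real.log_pos (by linarith)
  have hlogT : Real.log 2 ≤ Real.log T := Real.log_le_log (by norm_num) hT'
  have hsqrt : √(T : ℝ) ≤ T := Real.sqrt_le_iff.2 ⟨hT0.le, by nlinarith⟩
  have hsqrt0 : 0 < √(T : ℝ) := Real.sqrt_pos.2 hT0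
  have ha0 : (0 : ℝ) < a := lt_of_lt_of_le (by positivity) ha
  have hA : 0 < A := by
    by_contra h
    have := mul_nonpos_of_nonpos_of_nonneg (not_lt.1 h) hlog.le
    linarith
  rw [abs_of_pos hA] at hK
  obtain ⟨y₀⟩ := ‹Nonempty Y›
  have hM : 0 ≤ M := (hL y₀ y₀).1.trans (hL y₀ y₀).2
  have : Nonempty Y := ⟨y₀⟩
  by_cases htriv : M ≤ K * M * (Real.log T / √T)
  · have : {ω | ¬ ∀ h ∈ H, TemporalBound.expectedLoss L Pi h ≤
        TemporalBound.empiricalLoss L Z T h ω + 2 * TemporalBound.rademacher L H Pi m +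
          K * M * (Real.log T / √T)} = ∅ :=
      Set.eq_empty_of_forall_notMem fun ω hω =>
        hω (TemporalBound.forall_le_of_bound_le Z Pi hL hm T m htriv ω)
    rw [this]
    simp
  have hM0 : 0 < M := by
    rcases hM.eq_or_lt with h | h
    · rw [← h] at htriv; simp at htriv
    · exact h
  have hsmall : K * Real.log T < √T := by
    by_contra hcon
    refine htriv ?_
    have : 1 ≤ K * (Real.log T / √T) := by
      rw [← mul_div_assoc, one_le_div hsqrt0]; exact not_lt.1 hcon
    nlinarith
  have hKA : A ≤ K := by
    rw [hK]
    have : 0 ≤ 2 * √(A * (p + 2)) + 2 * A + T₀ / Real.log 2 := by positivity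
    linarith
  have hKT : T₀ / Real.log 2 ≤ K := by
    rw [hK]
    have : 0 ≤ 2 * √(A * (p + 2)) + 2 * A + A := by positivity
    linarith
  have hm0 : 0 < m := by
    rcases Nat.eq_zero_or_pos m with rfl | h
    · have h3 : (T : ℝ) < a := by exact_mod_cast (by simpa using h2 : T < a)
      have := mul_le_mul_of_nonneg_right hKA hlog.le
      linarith
    · exact h
  have hbig : T₀ ≤ T := by
    have h3 : T₀ ≤ K * Real.log 2 := (div_le_iff₀ hlog2).1 hKT
    have := mul_le_mul_of_nonneg_left hlogT hK0.le
    linarith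
  set s := 2 * √(A * (p + 2)) * (Real.log T / √T) with hs
  have hs0 : 0 ≤ s := by positivity
  have hrem : M * (s + 2 * (a / T)) ≤ K * M * (Real.log T / √T) := by
    have h3 : (a : ℝ) / T ≤ A * (Real.log T / √T) := by
      rw [← mul_div_assoc]
      gcongr
    have h4 : (2 * √(A * (p + 2)) + 2 * A) * (Real.log T / √T) ≤ K * (Real.log T / √T) := by
      refine mul_le_mul_of_nonneg_right ?_ (by positivity)
      rw [hK]
      have : 0 ≤ A + T₀ / Real.log 2 := by positivity
      linarith
    calc M * (s + 2 * (a / T)) ≤ M * (K * (Real.log T / √T)) := by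
          refine mul_le_mul_of_nonneg_left ?_ hM
          rw [hs]; linarith
      _ = _ := by ring
  have hmain := TemporalBound.measure_not_forall_le P hZ Pi hM0 hL hm hm0 (by omega) h1 h2 hs0
  refine (measure_mono ?_).trans (hmain.trans ?_)
  · intro ω hω hcon
    exact hω fun h hh => (hcon h hh).trans (by linarith)
  · have hβ := hmix a (by exact_mod_cast ha0)
    calc _ ≤ a * (ENNReal.ofReal (Real.exp (-(m * s ^ 2 / 2))) +
          m * ENNReal.ofReal (C * Real.exp (-d * a))) := by gcongr
      _ = ENNReal.ofReal (a * (Real.exp (-(m * s ^ 2 / 2)) + m * (C * Real.exp (-d * a)))) := by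
          rw [ENNReal.ofReal_mul (p := (a : ℝ)) (by positivity), ENNReal.ofReal_add (by positivity) (by positivity),
            ENNReal.ofReal_mul (p := (m : ℝ)) (by positivity), ENNReal.ofReal_natCast,
            ENNReal.ofReal_natCast]
      _ ≤ _ := ENNReal.ofReal_le_ofReal
          (TemporalBound.failure_probability_le hC hd hA hp hκ hT hm0 h1 h2 ha ha' hbig)
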